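/- Let $M,N\ge 1$ be integers. For a real $M\times N$ matrix $A$ let $$\mathrm{Bad}_A(M,N)=\Big\{x\in\mathbb R^M:\ \inf_{q\in\mathbb Z^N\setminus\{0\}}\|q\|^{N/M}\,\mathrm{dist}(Aq-x,\mathbb Z^M)>0\Big\},$$ where $\|\cdot\|$ is the Euclidean norm and $\mathrm{dist}$ the Euclidean distance. For $d\ge 1$, $0<\beta<1/3$ and $S\subseteq\mathbb R^d$, the hyperplane $\beta$-absolute game is played as follows. Bob chooses a closed ball $B_1\subseteq\mathbb R^d$ of positive radius. Once Bob has chosen $B_i$, of radius $\rho(B_i)$, Alice chooses an affine hyperplane $\mathcal L_i\subseteq\mathbb R^d$ and a number $0<\varepsilon_i\le\beta\rho(B_i)$, and Bob then chooses a closed ball $B_{i+1}\subseteq B_i$ with $\rho(B_{i+1})\ge\beta\rho(B_i)$ that is disjoint from the closed $\varepsilon_i$-neighbourhood of $\mathcal L_i$ (such a ball always exists, since $\beta<1/3$). Alice wins if and only if $S\cap\bigcap_{i\ge1}B_i\neq\varnothing$. The set $S$ is called hyperplane absolute winning (HAW) if there is $\beta_0\in(0,1/3]$ such that for every $0<\beta<\beta_0$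 Alice has a winning strategy in this game. Theorem. For all integers $M,N\ge1$ and every real $M\times N$ matrix $A$, the set $\mathrm{Bad}_A(M,N)\subseteq\mathbb R^M$ is HAW. -/

import Mathlib

/-- A closed ball of positive radius in Euclidean space `ℝ^d` (a move of Bob). -/
structure GameBall (d : ℕ) where
  center : EuclideanSpace ℝ (Fin d)
  radius : ℝ
  radius_pos : 0 < radius

/-- The set of points of a ball. -/
def GameBall.toSet {d : ℕ} (B : GameBall d) : Set (EuclideanSpace ℝ (Fin d)) :=
  Metric.closedBall B.center B.radius

/-- A move of Alice in the `k`-dimensional absolute game on `ℝ^d`: a (nonempty) `k`-dimensional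
affine subspace together with a number `ε > 0`. -/
structure PlaneMove (d k : ℕ) where
  plane : AffineSubspace ℝ (EuclideanSpace ℝ (Fin d))
  plane_nonempty : (plane : Set (EuclideanSpace ℝ (Fin d))).Nonempty
  finrank_direction : Module.finrank ℝ plane.direction = k
  width : ℝ
  width_pos : 0 < width

/-- The set forbidden by Alice's move: the closed `ε`-thickening of the chosen affine subspace. -/
def PlaneMove.toSet {d k : ℕ} (L : PlaneMove d k) : Set (EuclideanSpace ℝ (Fin d)) :=
  Metric.cthickening L.width (L.plane : Set (EuclideanSpace ℝ (Fin d)))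

/-- A strategy for Alice: her answer to Bob's first `n + 1` balls, for every `n`. -/
def AliceStrategy (d k : ℕ) : Type :=
  (n : ℕ) → (Fin (n + 1) → GameBall d) → PlaneMove d k

/-- Alice respects the rule `ε ≤ β ρ(B)`, where `B` is Bob's latest ball. -/
def AliceStrategy.IsLegal {d k : ℕ} (β : ℝ) (σ : AliceStrategy d k) : Prop :=
  ∀ (n : ℕ) (h : Fin (n + 1) → GameBall d), (σ n h).width ≤ β * (h (Fin.last n)).radius

/-- The ball `B'` is a legal answer of Bob when his previous ball is `B` and Alice chose `L`. -/
def IsLegalAnswer {d k : ℕ} (β : ℝ) (B : GameBall d) (L : PlaneMove d k) (B' : GameBall d) :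
    Prop :=
  B'.toSet ⊆ B.toSet ∧ β * B.radius ≤ B'.radius ∧ Disjoint B'.toSet L.toSet

/-- `B 0, B 1, …` are Bob's moves in an infinite run of the game in which Alice follows `σ`. -/
def IsRunAgainst {d k : ℕ} (β : ℝ) (σ : AliceStrategy d k) (B : ℕ → GameBall d) : Prop :=
  ∀ n : ℕ, IsLegalAnswer β (B n) (σ n (fun j => B j)) (B (n + 1))

/-- For `0 < β < 1/3` and `k < d` the game never stops: Bob always has a legal answer.  So only
infinite runs have to be considered in the definition of a winning strategy. -/
theorem exists_isLegalAnswer {d k : ℕ} (hk : k < d) {β : ℝ} (hβ : β < 1 / 3)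
    (B : GameBall d) (L : PlaneMove d k) (hL : L.width ≤ β * B.radius) :
    ∃ B' : GameBall d, IsLegalAnswer β B L B' := by
  have hρ := B.radius_pos
  obtain ⟨p, hp⟩ := L.plane_nonempty
  have hne : L.plane.direction ≠ ⊤ := by
    intro h
    have h1 := L.finrank_direction
    rw [h, finrank_top, finrank_euclideanSpace_fin] at h1
    omega
  obtain ⟨w, hw, hw0⟩ := (Submodule.ne_bot_iff _).1
    (fun h => hne ((Submodule.orthogonal_eq_bot_iff).1 h))
  obtain ⟨v, hv, hvn, hvt⟩ : ∃ v ∈ L.plane.directionᗮ, ‖v‖ = 1 ∧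
      0 ≤ inner ℝ v (B.center - p) := by
    have hu : ‖(‖w‖⁻¹ • w)‖ = 1 := by
      rw [norm_smul, norm_inv, norm_norm, inv_mul_cancel₀ (norm_ne_zero_iff.2 hw0)]
    rcases le_total 0 (inner ℝ (‖w‖⁻¹ • w) (B.center - p)) with h | h
    · exact ⟨_, Submodule.smul_mem _ _ hw, hu, h⟩
    · refine ⟨-(‖w‖⁻¹ • w), Submodule.neg_mem _ (Submodule.smul_mem _ _ hw), ?_, ?_⟩
      · rw [norm_neg, hu]
      · rw [inner_neg_left]; linarith
  refine ⟨⟨B.center + (2 / 3 * B.radius) • v, B.radius / 3, by linarith⟩, ?_, ?_, ?_⟩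
  · apply Metric.closedBall_subset_closedBall'
    rw [dist_eq_norm, add_sub_cancel_left, norm_smul, hvn, Real.norm_of_nonneg (by linarith)]
    linarith
  · change β * B.radius ≤ B.radius / 3
    nlinarith
  · rw [Set.disjoint_left]
    intro x hx hxL
    have hx' : ‖x - (B.center + (2 / 3 * B.radius) • v)‖ ≤ B.radius / 3 := by
      rw [← dist_eq_norm]; exact hx
    have hlt : L.width < B.radius / 3 := by nlinarith
    have hxt := Metric.cthickening_subset_thickening' (by linarith) hlt _ hxL
    obtain ⟨y, hy, hxy⟩ := Metric.mem_thickening_iff.1 hxt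
    rw [dist_eq_norm] at hxy
    have hyp : inner ℝ v (y - p) = 0 :=
      (Submodule.mem_orthogonal' _ _).1 hv _ (AffineSubspace.vsub_mem_direction hy hp)
    have h1 : |inner ℝ v (x - (B.center + (2 / 3 * B.radius) • v))| ≤ B.radius / 3 := by
      refine (abs_real_inner_le_norm _ _).trans ?_
      rw [hvn, one_mul]; exact hx'
    have h2 : |inner ℝ v (x - y)| < B.radius / 3 := by
      refine (abs_real_inner_le_norm _ _).trans_lt ?_
      rw [hvn, one_mul]; exact hxy
    have hvv : inner ℝ v v = (1 : ℝ) := by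
      rw [real_inner_self_eq_norm_sq, hvn, one_pow]
    simp only [inner_sub_right, inner_add_right, inner_smul_right, hvv] at h1 h2 hyp hvt
    have h3 := (abs_le.1 h1).1
    have h4 := (abs_lt.1 h2).2
    linarith

/-- `S ⊆ ℝ^d` is `k`-dimensionally `β`-absolute winning (meant for `k < d`, `0 < β < 1/3`): Alice
has a strategy such that in every run the intersection of Bob's balls meets `S`. -/
def IsBetaAbsoluteWinning {d : ℕ} (k : ℕ) (β : ℝ) (S : Set (EuclideanSpace ℝ (Fin d))) : Prop :=
  ∃ σ : AliceStrategy d k, σ.IsLegal β ∧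
    ∀ B : ℕ → GameBall d, IsRunAgainst β σ B → (S ∩ ⋂ n, (B n).toSet).Nonempty

/-- `S ⊆ ℝ^d` is `k`-dimensionally absolute winning. -/
def IsAbsoluteWinning {d : ℕ} (k : ℕ) (S : Set (EuclideanSpace ℝ (Fin d))) : Prop :=
  ∃ β₀ : ℝ, 0 < β₀ ∧ β₀ ≤ 1 / 3 ∧ ∀ β : ℝ, 0 < β → β < β₀ → IsBetaAbsoluteWinning k β S

/-- `S ⊆ ℝ^d` is hyperplane absolute winning (for `d ≥ 1`). -/
def IsHAW {d : ℕ} (S : Set (EuclideanSpace ℝ (Fin d))) : Prop :=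
  IsAbsoluteWinning (d - 1) S

/-- An integer vector, as a point of Euclidean space. -/
def intVec {n : ℕ} (q : Fin n → ℤ) : EuclideanSpace ℝ (Fin n) :=
  WithLp.toLp 2 (fun i => (q i : ℝ))

/-- The lattice `ℤ^n` in Euclidean space `ℝ^n`. -/
def intLattice (n : ℕ) : Set (EuclideanSpace ℝ (Fin n)) :=
  Set.range (intVec (n := n))

/-- The value `A q - x ∈ ℝ^M` of the system of affine forms given by `(A, x)` at `q ∈ ℤ^N`. -/
noncomputable def affineForms {M N : ℕ} (A : Matrix (Fin M) (Fin N) ℝ)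
    (x : EuclideanSpace ℝ (Fin M)) (q : Fin N → ℤ) : EuclideanSpace ℝ (Fin M) :=
  WithLp.toLp 2 (Matrix.mulVec A (fun j => (q j : ℝ))) - x

/-- The pair `(A, x)` is badly approximable:
`inf_{q ∈ ℤ^N, q ≠ 0} ‖q‖^{N/M} dist(A q - x, ℤ^M) > 0`, with Euclidean norm and distance. -/
def IsBadlyApproximable {M N : ℕ} (A : Matrix (Fin M) (Fin N) ℝ)
    (x : EuclideanSpace ℝ (Fin M)) : Prop :=
  0 < ⨅ q : {q : Fin N → ℤ // q ≠ 0},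
    ‖intVec q.1‖ ^ ((N : ℝ) / (M : ℝ)) * Metric.infDist (affineForms A x q.1) (intLattice M)

/-- The slice `Bad_A(M, N)`. -/
def badSlice {M N : ℕ} (A : Matrix (Fin M) (Fin N) ℝ) : Set (EuclideanSpace ℝ (Fin M)) :=
  {x | IsBadlyApproximable A x}

/-!
The proof is by transference to the transposed system. Fix `β < 1 / 3`, choose an integer
`E ≥ 1 / β` and put `D = E ^ N ≥ 1 / β`. For every `s` let `v s` be a nonzero integer vector of
length at most `M D ^ s` for which `Aᵀ (v s)` is as close to `ℤ^N` as possible; by Dirichlet's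
theorem its distance to `ℤ^N` is at most `E ^ (-M s)` (`exists_dualError_le`,
`exists_seq_dualError_le`). If the values `⟪v s, x⟫` stay at distance at least `c > 0` from the
integers, then `x` is badly approximable: from
`⟪v s, A q - x - p⟫ = ⟪Aᵀ (v s), q⟫ - ⟪v s, x⟫ - ⟪v s, p⟫`, with `s` such that the distance of
`⟪Aᵀ (v s), q⟫` to the integers is at most `c / 2`, one gets `c / 2 ≤ ‖v s‖ ‖A q - x - p‖`, and
`‖v s‖` is at most a constant times `‖q‖ ^ (N / M)`
(`isBadlyApproximable_of_forall_le_abs_inner_sub`).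

Hence Alice has to keep all the numbers `⟪v s, x⟫` away from the integers. The integer level sets of
`⟪v s, ·⟫` are parallel hyperplanes at distance `1 / ‖v s‖` from each other, so in a ball of radius
at most `1 / (4 M D ^ s)` only the one closest to the center matters, and Alice removes a
neighbourhood of it. This gains a fixed amount as long as the radius is not much smaller than
`1 / ‖v s‖`. The minimisers can be chosen such that `v (s + 1)` is equal to `v s` or longer than
`M D ^ s`; so at most one new vector has to be treated at every scale, and since the radius shrinks
by at most the factor `β ≥ 1 / D` in a move, Alice can treat the scales one after the other without
falling behind (`le_mul_pow_scaleIndex`,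
`isBetaAbsoluteWinning_setOf_forall_le_abs_inner_sub`).

Every scale gets treated only if the radii tend to `0`. If they do not, the balls have a ball in
common, and inside it there is a winning point, the outcome of another run with shrinking radii
(`isBetaAbsoluteWinning_of_tendsto_radius`).
-/

/-! ### Nested balls and the reduction to runs with shrinking radii -/

theorem Metric.dist_add_le_of_closedBall_subset {E : Type*} [NormedAddCommGroup E]
    [NormedSpace ℝ E] [Nontrivial E] {c c' : E} {r r' : ℝ} (hr' : 0 ≤ r')
    (h : Metric.closedBall c' r' ⊆ Metric.closedBall c r) : dist c' c + r' ≤ r := by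
  obtain ⟨u, hu, hcu⟩ : ∃ u : E, ‖u‖ = 1 ∧ c' - c = ‖c' - c‖ • u := by
    rcases eq_or_ne (c' - c) 0 with h0 | h0
    · obtain ⟨u, hu⟩ := exists_norm_eq E zero_le_one
      exact ⟨u, hu, by simp [h0]⟩
    · refine ⟨‖c' - c‖⁻¹ • (c' - c), ?_, ?_⟩
      · rw [norm_smul, norm_inv, norm_norm, inv_mul_cancel₀ (norm_ne_zero_iff.2 h0)]
      · rw [smul_smul, mul_inv_cancel₀ (norm_ne_zero_iff.2 h0), one_smul]
  have hmem : c' + r' • u ∈ Metric.closedBall c' r' := by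
    rw [mem_closedBall_iff_norm, add_sub_cancel_left, norm_smul, hu, mul_one,
      Real.norm_of_nonneg hr']
  have h1 := mem_closedBall_iff_norm.1 (h hmem)
  have h2 : c' + r' • u - c = (‖c' - c‖ + r') • u := by
    rw [add_smul, ← hcu]; abel
  rwa [h2, norm_smul, hu, mul_one, Real.norm_of_nonneg (by positivity), ← dist_eq_norm] at h1

/-- Bob can always answer with a ball of the least radius that the rules allow. -/
theorem exists_isLegalAnswer_radius_eq {d k : ℕ} (hk : k < d) {β : ℝ} (hβ0 : 0 < β)
    (hβ : β < 1 / 3) (B : GameBall d) (L : PlaneMove d k) (hL : L.width ≤ β * B.radius) :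
    ∃ B' : GameBall d, IsLegalAnswer β B L B' ∧ B'.radius = β * B.radius := by
  obtain ⟨B', h1, h2, h3⟩ := exists_isLegalAnswer hk hβ B L hL
  have hsub : Metric.closedBall B'.center (β * B.radius) ⊆ B'.toSet :=
    Metric.closedBall_subset_closedBall h2
  exact ⟨⟨B'.center, β * B.radius, mul_pos hβ0 B.radius_pos⟩,
    ⟨hsub.trans h1, le_rfl, h3.mono_left hsub⟩, rfl⟩

/-- Against a legal strategy there is a run that starts with a prescribed ball and whose radii
decrease as fast as possible. -/
theorem exists_isRunAgainst_radius_eq {d k : ℕ} (hk : k < d) {β : ℝ} (hβ0 : 0 < β)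
    (hβ : β < 1 / 3) {σ : AliceStrategy d k} (hσ : σ.IsLegal β) (B₀ : GameBall d) :
    ∃ B : ℕ → GameBall d, IsRunAgainst β σ B ∧ B 0 = B₀ ∧
      ∀ n, (B n).radius = β ^ n * B₀.radius := by
  choose f hf hfr using fun (n : ℕ) (h : Fin (n + 1) → GameBall d) =>
    exists_isLegalAnswer_radius_eq hk hβ0 hβ (h (Fin.last n)) (σ n h) (hσ n h)
  let H : (n : ℕ) → (Fin (n + 1) → GameBall d) := fun n =>
    Nat.rec (motive := fun n => Fin (n + 1) → GameBall d) (fun _ => B₀)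
      (fun n h => Fin.snoc (α := fun _ => GameBall d) h (f n h)) n
  have hH : ∀ n, H (n + 1) = Fin.snoc (α := fun _ => GameBall d) (H n) (f n (H n)) :=
    fun _ => rfl
  let B : ℕ → GameBall d := fun n => H n (Fin.last n)
  have hBs : ∀ n, B (n + 1) = f n (H n) := by
    intro n
    change H (n + 1) (Fin.last (n + 1)) = _
    rw [hH, Fin.snoc_last]
  have hHB : ∀ n, H n = fun j : Fin (n + 1) => B j := by
    intro n
    induction n with
    | zero => funext j; rw [Fin.fin_one_eq_zero j]; rfl
    | succ n ih =>
      funext j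
      refine Fin.lastCases ?_ (fun i => ?_) j
      · rfl
      · rw [hH, Fin.snoc_castSucc, ih]; rfl
  refine ⟨B, fun n => ?_, rfl, fun n => ?_⟩
  · rw [hBs, ← hHB]; exact hf n (H n)
  · induction n with
    | zero => simp [B, H]
    | succ n ih =>
      have := hfr n (H n)
      rw [hBs, this]
      change β * (B n).radius = _
      rw [ih, pow_succ]; ring

theorem IsRunAgainst.antitone_toSet {d k : ℕ} {β : ℝ} {σ : AliceStrategy d k}
    {B : ℕ → GameBall d} (hB : IsRunAgainst β σ B) : Antitone fun n => (B n).toSet :=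
  antitone_nat_of_succ_le fun n => (hB n).1

theorem IsRunAgainst.nonempty_iInter {d k : ℕ} {β : ℝ} {σ : AliceStrategy d k}
    {B : ℕ → GameBall d} (hB : IsRunAgainst β σ B) : (⋂ n, (B n).toSet).Nonempty :=
  IsCompact.nonempty_iInter_of_sequence_nonempty_isCompact_isClosed _
    (fun n => (hB n).1)
    (fun n => ⟨(B n).center, Metric.mem_closedBall_self (B n).radius_pos.le⟩)
    (isCompact_closedBall _ _) (fun _ => Metric.isClosed_closedBall)

/-- A strategy that wins every run whose radii tend to `0` wins every run: if the radii stay away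
from `0`, then the balls of the run have a ball in common, and this ball contains the outcome of
an auxiliary run that starts there and has shrinking radii. -/
theorem isBetaAbsoluteWinning_of_tendsto_radius {d k : ℕ} (hk : k < d) {β : ℝ} (hβ0 : 0 < β)
    (hβ : β < 1 / 3) {S : Set (EuclideanSpace ℝ (Fin d))} (σ : AliceStrategy d k)
    (hσ : σ.IsLegal β)
    (hwin : ∀ B : ℕ → GameBall d, IsRunAgainst β σ B →
      Filter.Tendsto (fun n => (B n).radius) Filter.atTop (nhds 0) →
        (S ∩ ⋂ n, (B n).toSet).Nonempty) :
    IsBetaAbsoluteWinning k β S := by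
  refine ⟨σ, hσ, fun B hB => ?_⟩
  have : Nonempty (Fin d) := ⟨⟨k, hk⟩⟩
  have hdist : ∀ {m n}, m ≤ n →
      dist (B n).center (B m).center + (B n).radius ≤ (B m).radius := fun hmn =>
    Metric.dist_add_le_of_closedBall_subset (B _).radius_pos.le (hB.antitone_toSet hmn)
  have hanti : Antitone fun n => (B n).radius := fun m n hmn => by
    have := hdist hmn
    have := dist_nonneg (x := (B n).center) (y := (B m).center)
    change (B n).radius ≤ (B m).radius
    linarith
  have hbdd : BddBelow (Set.range fun n => (B n).radius) :=
    ⟨0, by rintro _ ⟨n, rfl⟩; exact (B n).radius_pos.le⟩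
  have hlim := tendsto_atTop_ciInf hanti hbdd
  set r := ⨅ n, (B n).radius
  have hr0 : 0 ≤ r := le_ciInf fun n => (B n).radius_pos.le
  rcases hr0.eq_or_lt with hr | hr
  · exact hwin B hB (hr ▸ hlim)
  · obtain ⟨n, hn⟩ := (hlim.eventually_lt_const (show r < 2 * r by linarith)).exists
    -- The centers move by at most `(B n).radius - r` after time `n`.
    have hsub : ∀ m, Metric.closedBall (B n).center (2 * r - (B n).radius) ⊆ (B m).toSet := by
      intro m
      have hrm : ∀ m, r ≤ (B m).radius := fun m => ciInf_le hbdd m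
      rcases le_total n m with h | h
      · apply Metric.closedBall_subset_closedBall'
        have := hdist h
        rw [dist_comm]
        linarith [hrm m]
      · refine subset_trans ?_ (hB.antitone_toSet h)
        exact Metric.closedBall_subset_closedBall (by linarith [hrm n])
    obtain ⟨C, hC, hC0, hCr⟩ := exists_isRunAgainst_radius_eq hk hβ0 hβ hσ
      ⟨(B n).center, 2 * r - (B n).radius, by linarith⟩
    obtain ⟨x, hxS, hx⟩ := hwin C hC (by
      simp only [hCr]
      simpa using (tendsto_pow_atTop_nhds_zero_of_lt_one hβ0.le (by linarith)).mul_const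
        (2 * r - (B n).radius))
    refine ⟨x, hxS, Set.mem_iInter.2 fun m => hsub m ?_⟩
    have := Set.mem_iInter.1 hx 0
    rwa [hC0] at this

/-! ### Hyperplanes -/

/-- The hyperplane `{x | ⟪v, x⟫ = t}`, as the affine subspace through `(t / ‖v‖²) v` with
direction `v^⊥`. -/
noncomputable def hyperplane {d : ℕ} (v : EuclideanSpace ℝ (Fin d)) (t : ℝ) :
    AffineSubspace ℝ (EuclideanSpace ℝ (Fin d)) :=
  AffineSubspace.mk' ((t / ‖v‖ ^ 2) • v) (Submodule.span ℝ {v})ᗮ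

theorem mem_hyperplane {d : ℕ} {v : EuclideanSpace ℝ (Fin d)} (hv : v ≠ 0) {t : ℝ}
    {x : EuclideanSpace ℝ (Fin d)} : x ∈ hyperplane v t ↔ inner ℝ v x = t := by
  have h0 : ‖v‖ ^ 2 ≠ 0 := by positivity
  rw [hyperplane, AffineSubspace.mem_mk', Submodule.mem_orthogonal_singleton_iff_inner_right,
    vsub_eq_sub, inner_sub_right, inner_smul_right, real_inner_self_eq_norm_sq,
    div_mul_cancel₀ _ h0, sub_eq_zero]

theorem finrank_direction_hyperplane {d : ℕ} {v : EuclideanSpace ℝ (Fin d)} (hv : v ≠ 0) (t : ℝ) :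
    Module.finrank ℝ (hyperplane v t).direction = d - 1 := by
  rw [hyperplane, AffineSubspace.direction_mk']
  have h := Submodule.finrank_add_finrank_orthogonal (Submodule.span ℝ {v})
  rw [finrank_span_singleton hv, finrank_euclideanSpace_fin] at h
  omega

/-- The distance from `x` to the hyperplane is at most `|⟪v, x⟫ - t| / ‖v‖`. -/
theorem mul_norm_le_of_notMem_cthickening {d : ℕ} {v : EuclideanSpace ℝ (Fin d)} (hv : v ≠ 0)
    {t ε : ℝ} {x : EuclideanSpace ℝ (Fin d)}
    (hx : x ∉ Metric.cthickening ε (hyperplane v t : Set (EuclideanSpace ℝ (Fin d)))) :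
    ε * ‖v‖ ≤ |inner ℝ v x - t| := by
  by_contra! hlt
  have hv0 : 0 < ‖v‖ := norm_pos_iff.2 hv
  have h0 : ‖v‖ ^ 2 ≠ 0 := by positivity
  refine hx (Metric.mem_cthickening_of_dist_le x (x - ((inner ℝ v x - t) / ‖v‖ ^ 2) • v) _ _
    ((mem_hyperplane hv).2 ?_) ?_)
  · rw [inner_sub_right, inner_smul_right, real_inner_self_eq_norm_sq, div_mul_cancel₀ _ h0]
    ring
  · rw [dist_eq_norm, sub_sub_cancel, norm_smul, norm_div, Real.norm_eq_abs, norm_pow, norm_norm]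
    rw [div_mul_eq_mul_div, pow_two, mul_div_mul_right _ _ hv0.ne', div_le_iff₀ hv0]
    exact hlt.le

/-! ### Avoiding the integer values of a lacunary sequence of linear forms -/

/-- The scale treated at each stage: starting from scale `0`, Alice passes from scale `s` to scale
`s + 1` after a stage whose ball has a radius `ρ` with `ρ (W D ^ s) ≤ 1 / 4`. -/
noncomputable def scaleIndex (W D : ℝ) (ρ : ℕ → ℝ) : ℕ → ℕ
  | 0 => 0
  | n + 1 => open Classical in
    if ρ n * (W * D ^ scaleIndex W D ρ n) ≤ 1 / 4 then scaleIndex W D ρ n + 1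
    else scaleIndex W D ρ n

theorem scaleIndex_succ_of_le {W D : ℝ} {ρ : ℕ → ℝ} {n : ℕ}
    (h : ρ n * (W * D ^ scaleIndex W D ρ n) ≤ 1 / 4) :
    scaleIndex W D ρ (n + 1) = scaleIndex W D ρ n + 1 := by
  rw [scaleIndex, if_pos h]

theorem scaleIndex_succ_of_lt {W D : ℝ} {ρ : ℕ → ℝ} {n : ℕ}
    (h : 1 / 4 < ρ n * (W * D ^ scaleIndex W D ρ n)) :
    scaleIndex W D ρ (n + 1) = scaleIndex W D ρ n := by
  rw [scaleIndex, if_neg h.not_ge]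

theorem scaleIndex_congr {W D : ℝ} {ρ ρ' : ℕ → ℝ} {n : ℕ} (h : ∀ i < n, ρ i = ρ' i) :
    scaleIndex W D ρ n = scaleIndex W D ρ' n := by
  induction n with
  | zero => rfl
  | succ n ih =>
    rw [scaleIndex, scaleIndex, ih fun i hi => h i (by omega), h n (by omega)]

/-- If the radii shrink by at most the factor `β` and `1 ≤ β D`, then the scale being treated does
not lag behind the radius. -/
theorem le_mul_pow_scaleIndex {W D β : ℝ} {ρ : ℕ → ℝ} (hW : 0 < W) (hD : 0 ≤ D) (hβ : 0 ≤ β)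
    (hβD : 1 ≤ β * D) (hρ0 : ∀ n, 0 ≤ ρ n) (hρ : ∀ n, β * ρ n ≤ ρ (n + 1)) (n : ℕ) :
    min (ρ 0) (β / (4 * W)) ≤ ρ n * D ^ scaleIndex W D ρ n := by
  induction n with
  | zero => simp [scaleIndex]
  | succ n ih =>
    rcases le_or_gt (ρ n * (W * D ^ scaleIndex W D ρ n)) (1 / 4) with h | h
    · rw [scaleIndex_succ_of_le h]
      have hp : 0 ≤ D ^ scaleIndex W D ρ n := pow_nonneg hD _
      calc _ ≤ ρ n * D ^ scaleIndex W D ρ n := ih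
        _ ≤ (β * D) * (ρ n * D ^ scaleIndex W D ρ n) :=
          le_mul_of_one_le_left (mul_nonneg (hρ0 n) hp) hβD
        _ = (β * ρ n) * D ^ (scaleIndex W D ρ n + 1) := by ring
        _ ≤ _ := mul_le_mul_of_nonneg_right (hρ n) (pow_nonneg hD _)
    · rw [scaleIndex_succ_of_lt h]
      have hp : 0 ≤ D ^ scaleIndex W D ρ n := pow_nonneg hD _
      calc _ ≤ β / (4 * W) := min_le_right _ _
        _ = β * ((1 / 4) / W) := by field_simp
        _ ≤ β * (ρ n * D ^ scaleIndex W D ρ n) := by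
          refine mul_le_mul_of_nonneg_left ?_ hβ
          rw [div_le_iff₀ hW]
          linarith
        _ = (β * ρ n) * D ^ scaleIndex W D ρ n := by ring
        _ ≤ _ := mul_le_mul_of_nonneg_right (hρ n) hp

/-- If the radii tend to `0`, then every scale is treated at some stage. -/
theorem exists_scaleIndex_eq {W D : ℝ} {ρ : ℕ → ℝ}
    (hρ : Filter.Tendsto ρ Filter.atTop (nhds 0)) (s : ℕ) :
    ∃ n, scaleIndex W D ρ n = s ∧ ρ n * (W * D ^ s) ≤ 1 / 4 := by
  have key : ∀ m s, scaleIndex W D ρ m = s → ∃ n, scaleIndex W D ρ n = s ∧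
      ρ n * (W * D ^ s) ≤ 1 / 4 := by
    intro m s hm
    by_contra! hcon
    have hconst : ∀ j, scaleIndex W D ρ (m + j) = s := by
      intro j
      induction j with
      | zero => exact hm
      | succ j ih =>
        rw [← add_assoc, scaleIndex_succ_of_lt (by rw [ih]; exact hcon _ ih), ih]
    have hlim : Filter.Tendsto (fun n => ρ n * (W * D ^ s)) Filter.atTop (nhds 0) := by
      simpa using hρ.mul_const (W * D ^ s)
    obtain ⟨n, hn, hmn⟩ := ((hlim.eventually_lt_const
      (show (0 : ℝ) < 1 / 4 by norm_num)).and (Filter.eventually_ge_atTop m)).exists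
    have := hcon n (by rw [← hconst (n - m)]; congr 1; omega)
    linarith
  induction s with
  | zero => exact key 0 0 rfl
  | succ s ih =>
    obtain ⟨n, hn, hn'⟩ := ih
    refine key (n + 1) (s + 1) ?_
    rw [scaleIndex_succ_of_le (by rw [hn]; exact hn'), hn]

/-- The radii of the balls played so far, with the last one repeated for ever. -/
def historyRadius {d n : ℕ} (h : Fin (n + 1) → GameBall d) (i : ℕ) : ℝ :=
  (h ⟨min i n, by omega⟩).radius

/-- Let `s` be the scale being treated.  Alice removes the widest neighbourhood that she is allowed
to remove of the hyperplane `{x | ⟪v s, x⟫ = p}`, where `p` is the integer closest to the value of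
`⟪v s, ·⟫` at the center of the current ball. -/
noncomputable def hyperplaneStrategy {d : ℕ} {β : ℝ} (hβ : 0 < β)
    (v : ℕ → EuclideanSpace ℝ (Fin d)) (hv : ∀ s, v s ≠ 0) (W D : ℝ) :
    AliceStrategy d (d - 1) := fun n h =>
  let s := scaleIndex W D (historyRadius h) n
  let t : ℝ := round (inner ℝ (v s) (h (Fin.last n)).center)
  { plane := hyperplane (v s) t
    plane_nonempty := AffineSubspace.mk'_nonempty _ _
    finrank_direction := finrank_direction_hyperplane (hv s) t
    width := β * (h (Fin.last n)).radius
    width_pos := mul_pos hβ (h (Fin.last n)).radius_pos }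

/-- In a ball on which `⟪v, ·⟫` varies by at most `1 / 4` around the center, removing a
neighbourhood of one hyperplane keeps `⟪v, ·⟫` away from all integers. -/
theorem le_abs_inner_sub_intCast {d : ℕ} {v c x : EuclideanSpace ℝ (Fin d)} (hv : v ≠ 0)
    {ρ ε : ℝ} (hx : x ∈ Metric.closedBall c ρ) (hρ : ρ * ‖v‖ ≤ 1 / 4)
    (hxε : x ∉ Metric.cthickening ε
      (hyperplane v (round (inner ℝ v c) : ℝ) : Set (EuclideanSpace ℝ (Fin d)))) (p : ℤ) :
    min (1 / 4) (ε * ‖v‖) ≤ |inner ℝ v x - p| := by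
  rcases eq_or_ne p (round (inner ℝ v c)) with rfl | hp
  · exact (min_le_right _ _).trans (mul_norm_le_of_notMem_cthickening hv hxε)
  · refine (min_le_left _ _).trans ?_
    have h1 : |inner ℝ v x - inner ℝ v c| ≤ 1 / 4 := by
      rw [← inner_sub_right]
      refine (abs_real_inner_le_norm _ _).trans (le_trans ?_ hρ)
      rw [mul_comm]
      exact mul_le_mul_of_nonneg_right (mem_closedBall_iff_norm.1 hx) (norm_nonneg _)
    have h2 := abs_sub_round (inner ℝ v c)
    have h3 : (1 : ℝ) ≤ |(p : ℝ) - round (inner ℝ v c)| := by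
      exact_mod_cast Int.one_le_abs (sub_ne_zero.2 hp)
    have h4 := abs_sub_le (p : ℝ) (inner ℝ v x) (round (inner ℝ v c))
    have h5 := abs_sub_le (inner ℝ v x) (inner ℝ v c) (round (inner ℝ v c) : ℝ)
    rw [abs_sub_comm (p : ℝ) (inner ℝ v x)] at h4
    linarith

/-- Let `v` be a sequence of nonzero vectors with `‖v s‖ ≤ W D ^ s`, in which every new term is
longer than the bound for the preceding one.  If `1 ≤ β D`, then Alice can keep the values of all
the linear forms `⟪v s, ·⟫` uniformly away from the integers. -/
theorem isBetaAbsoluteWinning_setOf_forall_le_abs_inner_sub {d : ℕ} (hd : 1 ≤ d) {β : ℝ}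
    (hβ0 : 0 < β) (hβ : β < 1 / 3) {W D : ℝ} (hW : 0 < W) (hD : 0 < D) (hβD : 1 ≤ β * D)
    (v : ℕ → EuclideanSpace ℝ (Fin d)) (hv : ∀ s, v s ≠ 0) (hle : ∀ s, ‖v s‖ ≤ W * D ^ s)
    (hnew : ∀ s, v (s + 1) = v s ∨ W * D ^ s < ‖v (s + 1)‖) :
    IsBetaAbsoluteWinning (d - 1) β
      {x | ∃ c : ℝ, 0 < c ∧ ∀ (s : ℕ) (p : ℤ), c ≤ |inner ℝ (v s) x - p|} := by
  refine isBetaAbsoluteWinning_of_tendsto_radius (by omega) hβ0 hβ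
    (hyperplaneStrategy hβ0 v hv W D) (fun n h => le_rfl) fun B hB hlim => ?_
  obtain ⟨x, hx⟩ := hB.nonempty_iInter
  have hxB : ∀ n, x ∈ (B n).toSet := Set.mem_iInter.1 hx
  refine ⟨x, ?_, hx⟩
  set ρ : ℕ → ℝ := fun n => (B n).radius
  have hρ : ∀ n, 0 < ρ n := fun n => (B n).radius_pos
  set a := min (ρ 0) (β / (4 * W)) with ha
  have ha0 : 0 < a := lt_min (hρ 0) (by positivity)
  have hv0 : ∀ s, 0 < ‖v s‖ := fun s => norm_pos_iff.2 (hv s)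
  -- What the stage that treats scale `s` achieves.
  have hstage : ∀ (s : ℕ), ∃ n, a ≤ ρ n * D ^ s ∧
      ∀ p : ℤ, min (1 / 4) (β * ρ n * ‖v s‖) ≤ |inner ℝ (v s) x - p| := by
    intro s
    obtain ⟨n, hn, hn'⟩ := exists_scaleIndex_eq (W := W) (D := D) hlim s
    refine ⟨n, ?_, ?_⟩
    · rw [← hn]
      exact le_mul_pow_scaleIndex hW hD.le hβ0.le hβD (fun n => (hρ n).le)
        (fun n => (hB n).2.1) n
    · have hs : scaleIndex W D (historyRadius fun j : Fin (n + 1) => B j) n = s := by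
        rw [← hn]
        refine scaleIndex_congr fun i hi => ?_
        simp [historyRadius, min_eq_left hi.le, ρ]
      have hout := Set.disjoint_left.1 (hB n).2.2 (hxB (n + 1))
      change x ∉ Metric.cthickening (β * ρ n)
        (hyperplane (v (scaleIndex W D (historyRadius fun j : Fin (n + 1) => B j) n))
          (round (inner ℝ (v (scaleIndex W D (historyRadius fun j : Fin (n + 1) => B j) n))
            (B n).center) : ℝ) : Set (EuclideanSpace ℝ (Fin d))) at hout
      rw [hs] at hout
      exact le_abs_inner_sub_intCast (hv s) (hxB n)
        ((mul_le_mul_of_nonneg_left (hle s) (hρ n).le).trans hn') hout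
  set c := min (1 / 4) (β * a * min ‖v 0‖ (W / D)) with hc
  refine ⟨c, lt_min (by norm_num)
    (mul_pos (mul_pos hβ0 ha0) (lt_min (hv0 0) (by positivity))), fun s => ?_⟩
  -- Only the scales at which the sequence takes a new value matter.
  induction s with
  | zero =>
    intro p
    obtain ⟨n, hn, hp⟩ := hstage 0
    refine le_trans (min_le_min_left _ ?_) (hp p)
    rw [pow_zero, mul_one] at hn
    exact mul_le_mul (mul_le_mul_of_nonneg_left hn hβ0.le) (min_le_left _ _)
      (lt_min (hv0 0) (by positivity)).le (mul_pos hβ0 (hρ n)).le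
  | succ s ih =>
    rcases hnew s with h | h
    · rw [h]; exact ih
    · intro p
      obtain ⟨n, hn, hp⟩ := hstage (s + 1)
      refine le_trans (min_le_min_left _ ?_) (hp p)
      calc β * a * min ‖v 0‖ (W / D) ≤ β * (ρ n * D ^ (s + 1)) * (W / D) := by
            refine mul_le_mul (mul_le_mul_of_nonneg_left hn hβ0.le) (min_le_right _ _)
              (lt_min (hv0 0) (by positivity)).le ?_
            have := hρ n
            positivity
        _ = β * ρ n * (W * D ^ s) := by rw [pow_succ]; field_simp
        _ ≤ β * ρ n * ‖v (s + 1)‖ :=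
          mul_le_mul_of_nonneg_left h.le (mul_pos hβ0 (hρ n)).le

/-! ### Integer vectors and simultaneous approximation of the transposed system -/

theorem inner_intVec {n : ℕ} (y : Fin n → ℤ) (x : EuclideanSpace ℝ (Fin n)) :
    inner ℝ (intVec y) x = ∑ i, (y i : ℝ) * x i := by
  simp [intVec, PiLp.inner_apply, mul_comm]

theorem abs_intCast_le_norm_intVec {n : ℕ} (y : Fin n → ℤ) (i : Fin n) :
    |(y i : ℝ)| ≤ ‖intVec y‖ :=
  PiLp.norm_apply_le (intVec y) i

theorem one_le_norm_intVec {n : ℕ} {y : Fin n → ℤ} (hy : y ≠ 0) : 1 ≤ ‖intVec y‖ := by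
  obtain ⟨i, hi⟩ := Function.ne_iff.1 hy
  refine le_trans ?_ (abs_intCast_le_norm_intVec y i)
  exact_mod_cast Int.one_le_abs hi

theorem norm_intVec_le {n : ℕ} {y : Fin n → ℤ} {P : ℝ} (hP : 0 ≤ P) (h : ∀ i, |(y i : ℝ)| ≤ P) :
    ‖intVec y‖ ≤ n * P := by
  rw [← sq_le_sq₀ (norm_nonneg _) (by positivity), EuclideanSpace.real_norm_sq_eq, mul_pow]
  calc ∑ i, (intVec y i) ^ 2 ≤ ∑ _i : Fin n, P ^ 2 :=
        Finset.sum_le_sum fun i _ => sq_le_sq' (abs_le.1 (h i)).1 (abs_le.1 (h i)).2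
    _ = n * P ^ 2 := by simp
    _ ≤ (n : ℝ) ^ 2 * P ^ 2 := by
      refine mul_le_mul_of_nonneg_right ?_ (sq_nonneg P)
      exact_mod_cast Nat.le_self_pow two_ne_zero n

theorem finite_setOf_norm_intVec_le (n : ℕ) (r : ℝ) :
    {y : Fin n → ℤ | ‖intVec y‖ ≤ r}.Finite := by
  refine (Set.finite_Icc (fun _ : Fin n => -⌈r⌉) (fun _ => ⌈r⌉)).subset fun y hy => ?_
  have h : ∀ i, |y i| ≤ ⌈r⌉ := fun i => by
    have := ((abs_intCast_le_norm_intVec y i).trans hy).trans (Int.le_ceil r)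
    exact_mod_cast this
  exact ⟨fun i => (abs_le.1 (h i)).1, fun i => (abs_le.1 (h i)).2⟩

/-- The distance from `Aᵀ y` to `ℤ^N` in the sup norm. -/
noncomputable def dualError {M N : ℕ} (A : Matrix (Fin M) (Fin N) ℝ) (y : Fin M → ℤ) : ℝ :=
  ‖fun j => Matrix.vecMul (fun i => (y i : ℝ)) A j -
    round (Matrix.vecMul (fun i => (y i : ℝ)) A j)‖

theorem dualError_nonneg {M N : ℕ} (A : Matrix (Fin M) (Fin N) ℝ) (y : Fin M → ℤ) :
    0 ≤ dualError A y :=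
  norm_nonneg _

/-- Dirichlet's theorem for the transposed system, by the pigeonhole principle. -/
theorem exists_dualError_le {M N : ℕ} (A : Matrix (Fin M) (Fin N) ℝ) {P K : ℕ} (hK : 0 < K)
    (hPK : K ^ N < (P + 1) ^ M) :
    ∃ y : Fin M → ℤ, y ≠ 0 ∧ ‖intVec y‖ ≤ M * P ∧ dualError A y ≤ 1 / K := by
  have hK0 : (0 : ℝ) < K := Nat.cast_pos.2 hK
  let t : (Fin M → Fin (P + 1)) → Fin N → ℝ := fun a =>
    Matrix.vecMul (fun i => ((a i : ℕ) : ℝ)) A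
  let f : (Fin M → Fin (P + 1)) → Fin N → Fin K := fun a j =>
    ⟨⌊K * Int.fract (t a j)⌋₊, by
      rw [Nat.floor_lt (mul_nonneg hK0.le (Int.fract_nonneg _))]
      exact mul_lt_of_lt_one_right hK0 (Int.fract_lt_one _)⟩
  obtain ⟨a, b, hab, hf⟩ := Fintype.exists_ne_map_eq_of_card_lt f (by simpa using hPK)
  refine ⟨fun i => (a i : ℕ) - (b i : ℕ), fun h => hab ?_, ?_, ?_⟩
  · funext i
    have := congrFun h i
    simp only [Pi.zero_apply] at this
    exact Fin.ext (by omega)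
  · refine norm_intVec_le (Nat.cast_nonneg P) fun i => ?_
    have h1 := (a i).is_le
    have h2 := (b i).is_le
    have : |((a i : ℕ) : ℤ) - (b i : ℕ)| ≤ P := abs_le.2 ⟨by omega, by omega⟩
    exact_mod_cast this
  · refine (pi_norm_le_iff_of_nonneg (by positivity)).2 fun j => ?_
    have ht : Matrix.vecMul (fun i => ((((a i : ℕ) : ℤ) - (b i : ℕ) : ℤ) : ℝ)) A j =
        t a j - t b j := by
      simp [t, Matrix.vecMul, dotProduct, sub_mul, Finset.sum_sub_distrib]
    rw [ht, Real.norm_eq_abs]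
    refine (round_le _ (⌊t a j⌋ - ⌊t b j⌋)).trans ?_
    have h := congrArg Fin.val (congrFun hf j)
    have ha := Nat.floor_le (mul_nonneg hK0.le (Int.fract_nonneg (t a j)))
    have hb := Nat.floor_le (mul_nonneg hK0.le (Int.fract_nonneg (t b j)))
    have ha' := Nat.lt_floor_add_one (K * Int.fract (t a j))
    have hb' := Nat.lt_floor_add_one (K * Int.fract (t b j))
    change ⌊K * Int.fract (t a j)⌋₊ = ⌊K * Int.fract (t b j)⌋₊ at h
    rw [h] at ha ha'
    have e : t a j - t b j - ((⌊t a j⌋ - ⌊t b j⌋ : ℤ) : ℝ) =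
        Int.fract (t a j) - Int.fract (t b j) := by
      simp only [Int.fract]; push_cast; ring
    rw [e, le_div_iff₀ hK0, ← abs_of_pos hK0, ← abs_mul, abs_le]
    constructor <;> linarith

/-- Minimisers of `f` on the increasing sets `{a | g a ≤ R s}` can be chosen in such a way that a
minimiser is only replaced by one that is not in the preceding set. -/
theorem exists_seq_minimizers {α : Type*} (f g : α → ℝ) {R : ℕ → ℝ} (hR : Monotone R)
    (hfin : ∀ r, {a | g a ≤ r}.Finite) (hne : ∀ s, ∃ a, g a ≤ R s) :
    ∃ u : ℕ → α, (∀ s, g (u s) ≤ R s) ∧ (∀ s a, g a ≤ R s → f (u s) ≤ f a) ∧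
      ∀ s, u (s + 1) = u s ∨ R s < g (u (s + 1)) := by
  let P : ℕ → α → Prop := fun s a => g a ≤ R s ∧ ∀ b, g b ≤ R s → f a ≤ f b
  have hmin : ∀ s, ∃ a, P s a := fun s => by
    obtain ⟨a, ha, h⟩ := Set.exists_min_image _ f (hfin (R s)) (hne s)
    exact ⟨a, ha, h⟩
  have hstep : ∀ s (a : {a // P s a}), ∃ a' : {a // P (s + 1) a},
      (a' : α) = a ∨ R s < g a' := by
    rintro s ⟨a, ha⟩
    obtain ⟨w, hw⟩ := hmin (s + 1)
    by_cases h : R s < g w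
    · exact ⟨⟨w, hw⟩, Or.inr h⟩
    · exact ⟨⟨a, ha.1.trans (hR s.le_succ), fun b hb =>
        (ha.2 w (not_lt.1 h)).trans (hw.2 b hb)⟩, Or.inl rfl⟩
  choose next hnext using hstep
  let u : (s : ℕ) → {a // P s a} := fun s =>
    Nat.rec (motive := fun s => {a // P s a}) ⟨_, (hmin 0).choose_spec⟩ next s
  exact ⟨fun s => u s, fun s => (u s).2.1, fun s => (u s).2.2, fun s => hnext s (u s)⟩

/-- With `D = E ^ N`, the vector `v s` is chosen to minimise the distance from `Aᵀ y` to `ℤ^N` over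
the nonzero integer vectors `y` of length at most `M D ^ s`, and `v s` is kept for the scale `s + 1`
if it is still a minimiser there. -/
theorem exists_seq_dualError_le {M N : ℕ} (hM : 1 ≤ M) (A : Matrix (Fin M) (Fin N) ℝ) {E : ℕ}
    (hE : 1 ≤ E) :
    ∃ v : ℕ → Fin M → ℤ, (∀ s, v s ≠ 0) ∧ (∀ s, ‖intVec (v s)‖ ≤ M * ((E : ℝ) ^ N) ^ s) ∧
      (∀ s, dualError A (v s) ≤ 1 / ((E : ℝ) ^ M) ^ s) ∧
      ∀ s, v (s + 1) = v s ∨ M * ((E : ℝ) ^ N) ^ s < ‖intVec (v (s + 1))‖ := by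
  have hdir : ∀ s, ∃ y : {y : Fin M → ℤ // y ≠ 0}, ‖intVec y.1‖ ≤ M * ((E : ℝ) ^ N) ^ s ∧
      dualError A y.1 ≤ 1 / ((E : ℝ) ^ M) ^ s := by
    intro s
    obtain ⟨y, hy, h1, h2⟩ := exists_dualError_le A (P := (E ^ N) ^ s) (K := (E ^ M) ^ s)
      (by positivity) (by
        calc ((E ^ M) ^ s) ^ N = ((E ^ N) ^ s) ^ M := by ring
          _ < _ := Nat.pow_lt_pow_left (Nat.lt_succ_self _) (by omega))
    exact ⟨⟨y, hy⟩, by exact_mod_cast h1, by exact_mod_cast h2⟩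
  obtain ⟨u, h1, h2, h3⟩ := exists_seq_minimizers
    (fun y : {y : Fin M → ℤ // y ≠ 0} => dualError A y.1) (fun y => ‖intVec y.1‖)
    (R := fun s => M * ((E : ℝ) ^ N) ^ s)
    ((pow_right_mono₀ (one_le_pow₀ (Nat.one_le_cast.2 hE))).const_mul (Nat.cast_nonneg M))
    (fun r => (finite_setOf_norm_intVec_le M r).preimage Subtype.val_injective.injOn)
    (fun s => (hdir s).imp fun y hy => hy.1)
  refine ⟨fun s => (u s).1, fun s => (u s).2, h1, fun s => ?_, fun s => (h3 s).imp_left ?_⟩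
  · obtain ⟨y, hy, hy'⟩ := hdir s
    exact (h2 s y hy).trans hy'
  · exact congrArg Subtype.val

/-! ### Transference -/

/-- The transference inequality: it results from
`⟪y, A q - x - p⟫ = ⟪Aᵀ y, q⟫ - ⟪y, x⟫ - ⟪y, p⟫`, in which `⟪Aᵀ y, q⟫` is an integer up to
`N · dualError A y · ‖q‖`. -/
theorem div_norm_le_infDist_affineForms {M N : ℕ} (A : Matrix (Fin M) (Fin N) ℝ)
    {x : EuclideanSpace ℝ (Fin M)} {y : Fin M → ℤ} (hy : y ≠ 0) {c : ℝ}
    (hc : ∀ p : ℤ, c ≤ |inner ℝ (intVec y) x - p|) (q : Fin N → ℤ) :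
    (c - N * (dualError A y * ‖intVec q‖)) / ‖intVec y‖ ≤
      Metric.infDist (affineForms A x q) (intLattice M) := by
  refine (Metric.le_infDist (Set.range_nonempty _)).2 ?_
  rintro _ ⟨p, rfl⟩
  have hy0 : 0 < ‖intVec y‖ := one_pos.trans_le (one_le_norm_intVec hy)
  rw [div_le_iff₀ hy0, dist_eq_norm, mul_comm ‖_‖]
  refine le_trans ?_ (abs_real_inner_le_norm _ _)
  set t := Matrix.vecMul (fun i => (y i : ℝ)) A with ht
  have hq : ∑ i, (y i : ℝ) * (Matrix.mulVec A fun j => (q j : ℝ)) i = ∑ j, t j * q j :=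
    Matrix.dotProduct_mulVec _ _ _
  have hinner : inner ℝ (intVec y) (affineForms A x q - intVec p) =
      (∑ j, (t j - round (t j)) * q j) -
        (inner ℝ (intVec y) x - ((∑ j, round (t j) * q j - ∑ i, y i * p i : ℤ) : ℝ)) := by
    rw [affineForms, inner_sub_right, inner_sub_right, inner_intVec y (intVec p), inner_intVec]
    simp only [intVec, hq, sub_mul, Finset.sum_sub_distrib]
    push_cast
    ring
  have herr : |∑ j, (t j - round (t j)) * q j| ≤ N * (dualError A y * ‖intVec q‖) := by
    refine (Finset.abs_sum_le_sum_abs _ _).trans ?_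
    calc ∑ j, |(t j - round (t j)) * q j| ≤ ∑ _j : Fin N, dualError A y * ‖intVec q‖ := by
          refine Finset.sum_le_sum fun j _ => ?_
          rw [abs_mul]
          exact mul_le_mul (norm_le_pi_norm (fun j => t j - round (t j)) j)
            (abs_intCast_le_norm_intVec q j) (abs_nonneg _) (dualError_nonneg A y)
      _ = _ := by simp
  have h1 := hc (∑ j, round (t j) * q j - ∑ i, y i * p i)
  rw [hinner, abs_sub_comm]
  have h2 := abs_sub_abs_le_abs_sub
    (inner ℝ (intVec y) x - ((∑ j, round (t j) * q j - ∑ i, y i * p i : ℤ) : ℝ))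
    (∑ j, (t j - round (t j)) * q j)
  linarith

/-- Transference: a point at which the linear forms of a sequence of good approximations to the
transposed system stay away from the integers is badly approximable.  For given `q`, the
approximation `v s` is used for the least `s` for which the bound on `dualError A (v s)` makes the
error `N · dualError A (v s) · ‖q‖` at most `c / 2`. -/
theorem isBadlyApproximable_of_forall_le_abs_inner_sub {M N : ℕ} (hM : 1 ≤ M) (hN : 1 ≤ N)
    (A : Matrix (Fin M) (Fin N) ℝ) {E : ℕ} (hE : 2 ≤ E) {v : ℕ → Fin M → ℤ} (hv : ∀ s, v s ≠ 0)
    (hle : ∀ s, ‖intVec (v s)‖ ≤ M * ((E : ℝ) ^ N) ^ s)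
    (herr : ∀ s, dualError A (v s) ≤ 1 / ((E : ℝ) ^ M) ^ s) {x : EuclideanSpace ℝ (Fin M)} {c : ℝ}
    (hc0 : 0 < c) (hc : ∀ (s : ℕ) (p : ℤ), c ≤ |inner ℝ (intVec (v s)) x - p|) :
    IsBadlyApproximable A x := by
  have hM0 : (0 : ℝ) < M := Nat.cast_pos.2 hM
  have hN0 : (1 : ℝ) ≤ N := Nat.one_le_cast.2 hN
  have hE0 : (1 : ℝ) < E := Nat.one_lt_cast.2 hE
  have hc1 : c ≤ 1 := by
    have := (hc 0 _).trans (abs_sub_round (inner ℝ (intVec (v 0)) x))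
    linarith
  set b : ℝ := (E : ℝ) ^ M with hb
  have hb0 : 0 < b := by positivity
  have hb1 : 1 < b := one_lt_pow₀ hE0 (by omega)
  set κ : ℝ := (N : ℝ) / M with hκ
  have hκ0 : 0 ≤ κ := by positivity
  have hpow : ∀ s : ℕ, ((E : ℝ) ^ N) ^ s = (b ^ s) ^ κ := by
    intro s
    rw [hb, ← pow_mul, ← pow_mul, ← Real.rpow_natCast, ← Real.rpow_natCast, ← Real.rpow_mul
      (by positivity), hκ]
    congr 1
    push_cast
    field_simp
  have : Nonempty {q : Fin N → ℤ // q ≠ 0} :=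
    ⟨⟨fun _ => 1, fun h => one_ne_zero (congrFun h ⟨0, hN⟩)⟩⟩
  refine lt_of_lt_of_le (b := (c / 2) / (M * (b * (2 * N / c)) ^ κ)) (by positivity)
    (le_ciInf fun q => ?_)
  have hT : 1 ≤ ‖intVec q.1‖ := one_le_norm_intVec q.2
  set T := ‖intVec q.1‖
  have hX : 1 ≤ 2 * N / c * T := by
    rw [div_mul_eq_mul_div, le_div_iff₀ hc0]
    nlinarith
  obtain ⟨n, hn, hn'⟩ := exists_nat_pow_near hX hb1
  have hdist := div_norm_le_infDist_affineForms A (hv (n + 1)) (hc (n + 1)) q.1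
  have hsmall : N * (dualError A (v (n + 1)) * T) ≤ c / 2 := by
    have hpos : 0 < b ^ (n + 1) := by positivity
    calc N * (dualError A (v (n + 1)) * T) ≤ N * (1 / b ^ (n + 1) * T) := by
          gcongr; exact herr _
      _ = N * T / b ^ (n + 1) := by ring
      _ ≤ c / 2 := by
        rw [div_mul_eq_mul_div, div_lt_iff₀ hc0] at hn'
        rw [div_le_div_iff₀ hpos two_pos]
        linarith
  have hnorm : ‖intVec (v (n + 1))‖ ≤ M * ((b * (2 * N / c)) ^ κ * T ^ κ) := by
    refine (hle _).trans (mul_le_mul_of_nonneg_left ?_ hM0.le)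
    rw [hpow, ← Real.mul_rpow (by positivity) (by positivity)]
    refine Real.rpow_le_rpow (by positivity) ?_ hκ0
    rw [pow_succ, mul_comm, mul_assoc]
    exact mul_le_mul_of_nonneg_left hn hb0.le
  have hv0 : 0 < ‖intVec (v (n + 1))‖ := one_pos.trans_le (one_le_norm_intVec (hv _))
  have hTκ : 0 < T ^ κ := Real.rpow_pos_of_pos (by linarith) _
  calc (c / 2) / (M * (b * (2 * N / c)) ^ κ)
      = T ^ κ * ((c / 2) / (M * ((b * (2 * N / c)) ^ κ * T ^ κ))) := by field_simp
    _ ≤ T ^ κ * ((c - N * (dualError A (v (n + 1)) * T)) / ‖intVec (v (n + 1))‖) := by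
      refine mul_le_mul_of_nonneg_left ?_ hTκ.le
      exact div_le_div₀ (by linarith) (by linarith) hv0 hnorm
    _ ≤ _ := mul_le_mul_of_nonneg_left hdist hTκ.le

theorem IsBetaAbsoluteWinning.mono {d k : ℕ} {β : ℝ} {S T : Set (EuclideanSpace ℝ (Fin d))}
    (h : IsBetaAbsoluteWinning k β S) (hST : S ⊆ T) : IsBetaAbsoluteWinning k β T := by
  obtain ⟨σ, hσ, hwin⟩ := h
  exact ⟨σ, hσ, fun B hB => (hwin B hB).mono (Set.inter_subset_inter_left _ hST)⟩

theorem mainTheorem2 (M N : ℕ) (hM : 1 ≤ M) (hN : 1 ≤ N) (A : Matrix (Fin M) (Fin N) ℝ) :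
    IsHAW (badSlice A) := by
  refine ⟨1 / 3, by norm_num, le_rfl, fun β hβ0 hβ => ?_⟩
  obtain ⟨E, hEβ⟩ := exists_nat_ge (1 / β)
  rw [div_le_iff₀ hβ0] at hEβ
  have hE : 2 ≤ E := by
    have h : (1 : ℝ) < E := by
      by_contra! h
      nlinarith
    exact_mod_cast h
  have hE1 : (1 : ℝ) ≤ E := Nat.one_le_cast.2 (by omega)
  obtain ⟨v, hv, hle, herr, hnew⟩ := exists_seq_dualError_le hM A (E := E) (by omega)
  refine (isBetaAbsoluteWinning_setOf_forall_le_abs_inner_sub hM hβ0 hβ (W := M)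
    (D := (E : ℝ) ^ N) (Nat.cast_pos.2 hM) (by positivity) ?_ (fun s => intVec (v s)) ?_ hle
    (fun s => (hnew s).imp_left (congrArg intVec))).mono ?_
  · calc (1 : ℝ) ≤ β * E := by linarith
      _ ≤ β * (E : ℝ) ^ N :=
        mul_le_mul_of_nonneg_left (le_self_pow₀ hE1 (by omega)) hβ0.le
  · intro s
    exact norm_pos_iff.1 (one_pos.trans_le (one_le_norm_intVec (hv s)))
  · rintro x ⟨c, hc0, hc⟩
    exact isBadlyApproximable_of_forall_le_abs_inner_sub hM hN A hE hv hle herr hc0 hc
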